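/- **Minimum eigenvalue of the Gram matrix at initialization.** Let $\sigma_0:\mathbb R\to\mathbb R$ be twice differentiable with $|\sigma_0(t)|\le C_1\max(|t|,1)$, $|\sigma_0'(t)|\le C_1$ and $|\sigma_0''(t)|\le C_1$ for all $t\in\mathbb R$, and suppose that $\sigma_0$ is not an affine function. For $\theta=(u,w,b)\in\mathbb R^{d}\times\mathbb R^d\times\mathbb R$, $\omega=(a,w,b)\in\mathbb R\times\mathbb R^d\times\mathbb R$ and $z\in\mathbb R^d$ put $$\sigma(z,\theta)=u\,\sigma_0(w^\top z+b)\in\mathbb R^d,\qquad h(z,\omega)=a\,\sigma_0(w^\top z+b)\in\mathbb R .$$ For $\alpha>0$, a family $\nu=(\nu^s)_{s\in[0,1]}$ of probability measures on $\mathbb R^{2d+1}$ and a probability measure $\tau$ on $\mathbb R^{d+2}$, let $Z_\nu(x,\cdot)$ be the solution on $[0,1]$ of $$\frac{d}{ds}Z_\nu(x,s)=\alpha\int\sigma(Z_\nu(x,s),\theta)\,d\nu^s(\theta),\qquad Z_\nu(x,0)=x,$$ and let $p_\nu(x,\cdot)$ be the solution on $[0,1]$ of the adjoint equation $$\frac{d}{ds}p_\nu^\top(x,s)=-\alpha\,p_\nu^\top(x,s)\int\nabla_z\sigma(Z_\nu(x,s),\theta)\,d\nu^s(\theta),\qquad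 p_\nu^\top(x,1)=\int\nabla_z h(Z_\nu(x,1),\omega)\,d\tau(\omega).$$ For inputs $x_1,\dots,x_n\in\mathbb R^d$, let $J_1(\tau,\nu,\theta,s)$ and $J_2(\nu,\omega)$ be the matrices with $i$-th rows $p_\nu^\top(x_i,s)\nabla_\theta\sigma(Z_\nu(x_i,s),\theta)$ and $\nabla_\omega h(Z_\nu(x_i,1),\omega)$ respectively, and define the $n\times n$ Gram matrices $$G_1(\tau,\nu)=\int_0^1\mathbb E_{\theta\sim\nu^s}\big[J_1J_1^\top\big]\,ds,\qquad G_2(\tau,\nu)=\mathbb E_{\omega\sim\tau}\big[J_2J_2^\top\big],\qquad G(\tau,\nu)=\alpha^2G_1(\tau,\nu)+G_2(\tau,\nu).$$ Let $\tau_0$ be the standard Gaussian measure on $\mathbb R^{d+2}$ and let $\nu_0^s$ be the standard Gaussian measure on $\mathbb R^{2d+1}$ for every $s\in[0,1]$. Fix $\sigma_0$, $C_1$ and $C_{\max}<1$. Then for every dimension $d$ there is a constant $\Lambda(d)>0$, depending (besides the fixed $\sigma_0,C_1,C_{\max}$) only on $d$, such that for every $n\ge1$, every $\alpha>0$ and all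 training data $(x_i,y(x_i))_{i=1}^n$ with $\|x_i\|_2=1$ and $|y(x_i)|\le1$ for all $i$, and $\langle x_i,x_j\rangle\le C_{\max}$ for all $i\ne j$, $$\lambda_{\min}\big(G(\tau_0,\nu_0)\big)\ \ge\ \lambda_{\min}\big(G_2(\tau_0,\nu_0)\big)\ \ge\ \Lambda(d)\ >\ 0 .$$ -/

import Mathlib

open MeasureTheory ProbabilityTheory
open scoped InnerProductSpace

noncomputable section

namespace MeanFieldResNet

/-- The input space `ℝ^d` with its Euclidean norm. -/
abbrev Input (d : ℕ) : Type := EuclideanSpace ℝ (Fin d)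

/-- Coordinates of a residual-layer parameter `θ = (u, w, b)` with `u, w ∈ ℝ^d` and `b ∈ ℝ`. -/
abbrev ThetaIdx (d : ℕ) : Type := Fin d ⊕ (Fin d ⊕ Unit)

/-- The space `ℝ^{2d+1}` of residual-layer parameters `θ = (u, w, b)`. -/
abbrev Theta (d : ℕ) : Type := EuclideanSpace ℝ (ThetaIdx d)

/-- Coordinates of an output-layer parameter `ω = (a, w, b)` with `w ∈ ℝ^d` and `a, b ∈ ℝ`. -/
abbrev OmegaIdx (d : ℕ) : Type := Unit ⊕ (Fin d ⊕ Unit)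

/-- The space `ℝ^{d+2}` of output-layer parameters `ω = (a, w, b)`. -/
abbrev Omega (d : ℕ) : Type := EuclideanSpace ℝ (OmegaIdx d)

variable {d n : ℕ}

/-- The component `u` of `θ = (u, w, b)`. -/
def thetaU (θ : Theta d) : Input d := WithLp.toLp 2 fun k => θ (Sum.inl k)

/-- The component `w` of `θ = (u, w, b)`. -/
def thetaW (θ : Theta d) : Input d := WithLp.toLp 2 fun k => θ (Sum.inr (Sum.inl k))

/-- The component `b` of `θ = (u, w, b)`. -/
def thetaB (θ : Theta d) : ℝ := θ (Sum.inr (Sum.inr ()))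

/-- The component `a` of `ω = (a, w, b)`. -/
def omegaA (ω : Omega d) : ℝ := ω (Sum.inl ())

/-- The component `w` of `ω = (a, w, b)`. -/
def omegaW (ω : Omega d) : Input d := WithLp.toLp 2 fun k => ω (Sum.inr (Sum.inl k))

/-- The component `b` of `ω = (a, w, b)`. -/
def omegaB (ω : Omega d) : ℝ := ω (Sum.inr (Sum.inr ()))

/-- The residual block `σ(z, θ) = u σ₀(wᵀ z + b)`. -/
def resBlock (σ₀ : ℝ → ℝ) (z : Input d) (θ : Theta d) : Input d :=
  σ₀ (⟪thetaW θ, z⟫_ℝ + thetaB θ) • thetaU θ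

/-- The predictor `h(z, ω) = a σ₀(wᵀ z + b)`. -/
def predictor (σ₀ : ℝ → ℝ) (z : Input d) (ω : Omega d) : ℝ :=
  omegaA ω * σ₀ (⟪omegaW ω, z⟫_ℝ + omegaB ω)

/-- `z` solves the mean-field ResNet ODE on `[0, 1]` started at `x`:
`dz/ds = α ∫ σ(z(s), θ) dν^s(θ)`, `z(0) = x`. -/
def IsResNetTrajectory (α : ℝ) (σ₀ : ℝ → ℝ) (ν : ℝ → Measure (Theta d)) (x : Input d)
    (z : ℝ → Input d) : Prop :=
  z 0 = x ∧ ∀ s ∈ Set.Icc (0 : ℝ) 1,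
    HasDerivWithinAt z (α • ∫ θ, resBlock σ₀ (z s) θ ∂(ν s)) (Set.Icc 0 1) s

open Classical in
/-- The solution `s ↦ Z_ν(x, s)` of the mean-field ResNet ODE (the zero function if there is no
solution). -/
def resNetFlow (α : ℝ) (σ₀ : ℝ → ℝ) (ν : ℝ → Measure (Theta d)) (x : Input d) : ℝ → Input d :=
  if h : ∃ z, IsResNetTrajectory α σ₀ ν x z then h.choose else 0

/-- `p` solves the adjoint ODE on `[0, 1]`:
`dpᵀ/ds = -α pᵀ(s) ∫ ∇_z σ(Z_ν(x, s), θ) dν^s(θ)`, `p(1) = ∫ ∇_z h(Z_ν(x, 1), ω) dτ(ω)`. -/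
def IsAdjointTrajectory (α : ℝ) (σ₀ : ℝ → ℝ) (τ : Measure (Omega d)) (ν : ℝ → Measure (Theta d))
    (x : Input d) (p : ℝ → Input d) : Prop :=
  p 1 = ∫ ω, gradient (fun z => predictor σ₀ z ω) (resNetFlow α σ₀ ν x 1) ∂τ ∧
  ∀ s ∈ Set.Icc (0 : ℝ) 1,
    HasDerivWithinAt p
      (-(α • ContinuousLinearMap.adjoint
          (∫ θ, fderiv ℝ (fun z => resBlock σ₀ z θ) (resNetFlow α σ₀ ν x s) ∂(ν s)) (p s)))
      (Set.Icc 0 1) s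

open Classical in
/-- The solution `s ↦ p_ν(x, s)` of the adjoint ODE (the zero function if there is no
solution). -/
def adjointFlow (α : ℝ) (σ₀ : ℝ → ℝ) (τ : Measure (Omega d)) (ν : ℝ → Measure (Theta d))
    (x : Input d) : ℝ → Input d :=
  if h : ∃ p, IsAdjointTrajectory α σ₀ τ ν x p then h.choose else 0

/-- The matrix `J₁(τ, ν, θ, s)`, whose `i`-th row is `p_νᵀ(x_i, s) ∇_θ σ(Z_ν(x_i, s), θ)`. -/
def J1 (α : ℝ) (σ₀ : ℝ → ℝ) (x : Fin n → Input d) (τ : Measure (Omega d))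
    (ν : ℝ → Measure (Theta d)) (θ : Theta d) (s : ℝ) : Matrix (Fin n) (ThetaIdx d) ℝ :=
  Matrix.of fun i k =>
    (ContinuousLinearMap.adjoint
      (fderiv ℝ (fun θ' => resBlock σ₀ (resNetFlow α σ₀ ν (x i) s) θ') θ)
      (adjointFlow α σ₀ τ ν (x i) s)) k

/-- The matrix `J₂(ν, ω)`, whose `i`-th row is `∇_ω h(Z_ν(x_i, 1), ω)`. -/
def J2 (α : ℝ) (σ₀ : ℝ → ℝ) (x : Fin n → Input d) (ν : ℝ → Measure (Theta d)) (ω : Omega d) :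
    Matrix (Fin n) (OmegaIdx d) ℝ :=
  Matrix.of fun i k =>
    (gradient (fun ω' => predictor σ₀ (resNetFlow α σ₀ ν (x i) 1) ω') ω) k

/-- The Gram matrix `G₁(τ, ν) = ∫₀¹ E_{θ ∼ ν^s} [J₁ J₁ᵀ] ds` of the residual layers. -/
def gram1 (α : ℝ) (σ₀ : ℝ → ℝ) (x : Fin n → Input d) (τ : Measure (Omega d))
    (ν : ℝ → Measure (Theta d)) : Matrix (Fin n) (Fin n) ℝ :=
  Matrix.of fun i j =>
    ∫ s in (0 : ℝ)..1, ∫ θ, (J1 α σ₀ x τ ν θ s * (J1 α σ₀ x τ ν θ s).transpose) i j ∂(ν s)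

/-- The Gram matrix `G₂(τ, ν) = E_{ω ∼ τ} [J₂ J₂ᵀ]` of the output layer. -/
def gram2 (α : ℝ) (σ₀ : ℝ → ℝ) (x : Fin n → Input d) (τ : Measure (Omega d))
    (ν : ℝ → Measure (Theta d)) : Matrix (Fin n) (Fin n) ℝ :=
  Matrix.of fun i j => ∫ ω, (J2 α σ₀ x ν ω * (J2 α σ₀ x ν ω).transpose) i j ∂τ

/-- The full Gram matrix `G(τ, ν) = α² G₁(τ, ν) + G₂(τ, ν)`. -/
def gram (α : ℝ) (σ₀ : ℝ → ℝ) (x : Fin n → Input d) (τ : Measure (Omega d))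
    (ν : ℝ → Measure (Theta d)) : Matrix (Fin n) (Fin n) ℝ :=
  α ^ 2 • gram1 α σ₀ x τ ν + gram2 α σ₀ x τ ν

/-- The smallest eigenvalue of a (nonempty, symmetric) real matrix. -/
def lambdaMin (A : Matrix (Fin n) (Fin n) ℝ) : ℝ := sInf (spectrum ℝ A)

/-- The output-layer distribution at initialization: the standard Gaussian on `ℝ^{d+2}`. -/
def initTau (d : ℕ) : Measure (Omega d) := stdGaussian (Omega d)

/-- The residual-layer distribution at initialization: at every depth `s`, the standard Gaussian
on `ℝ^{2d+1}`. -/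
def initNu (d : ℕ) : ℝ → Measure (Theta d) := fun _ => stdGaussian (Theta d)

/-- Assumption on the training data `(x_i, y(x_i))`: unit inputs, labels bounded by `1`, and
pairwise inner products of the (distinct) inputs at most `Cmax < 1`. -/
structure DataAssumption (Cmax : ℝ) (x : Fin n → Input d) (y : Input d → ℝ) : Prop where
  cmax_lt_one : Cmax < 1
  norm_eq_one : ∀ i, ‖x i‖ = 1
  label_le_one : ∀ i, |y (x i)| ≤ 1
  inner_le : ∀ i j, i ≠ j → ⟪x i, x j⟫_ℝ ≤ Cmax

/-- Assumption on the activation: `σ₀` is twice differentiable, has at most linear growth, and has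
bounded first and second derivatives. -/
structure ActivationAssumption (C₁ : ℝ) (σ₀ : ℝ → ℝ) : Prop where
  differentiable : Differentiable ℝ σ₀
  differentiable_deriv : Differentiable ℝ (deriv σ₀)
  growth : ∀ t, |σ₀ t| ≤ C₁ * max |t| 1
  deriv_le : ∀ t, |deriv σ₀ t| ≤ C₁
  deriv_deriv_le : ∀ t, |deriv (deriv σ₀) t| ≤ C₁

end MeanFieldResNet

end

noncomputable section

/-! ### Ridge functions -/

/-! At initialization the Gaussians are symmetric under `u ↦ -u` and `a ↦ -a`. Hence the velocity
field vanishes and the flow stays at `x`; the adjoint starts from zero and stays zero. So `G₁ = 0`,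
`G = G₂`, and the first inequality is an equality (`gram_init`).

For `G₂`, keep only the derivative in the bias `b`: the quadratic form at `c` is at least `E (∑ c_i
a σ₀'(w·x_i + b))²`. If this vanishes, full support of the Gaussian makes `∑ c_i σ₀'(w·x_i + b)`
zero for all `w, b`. Bounded ridge functions in distinct directions cannot cancel unless all are
constant (`ridge_profile_const_of_sum_eq_zero`), and `σ₀'` is not constant, so `c = 0`
(`biasForm_pos`). Compactness in `(x, c)` gives a positive bound for each `n`, and packing on the
sphere leaves finitely many `n`. -/

theorem eq_zero_of_bounded_of_forall_add_sub_eq {g : ℝ → ℝ} {C h k : ℝ} (hC : ∀ t, |g t| ≤ C)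
    (hg : ∀ t, g (t + h) - g t = k) : k = 0 := by
  have key : ∀ m : ℕ, g (m * h) = g 0 + m * k := by
    intro m
    induction m with
    | zero => simp
    | succ m ih =>
      have := hg (m * h)
      push_cast
      rw [show ((m : ℝ) + 1) * h = m * h + h by ring]
      linarith
  by_contra hk
  obtain ⟨m, hm⟩ := exists_nat_gt (2 * C / |k|)
  rw [div_lt_iff₀ (abs_pos.2 hk)] at hm
  have h1 : (m : ℝ) * |k| ≤ 2 * C := by
    calc (m : ℝ) * |k| = |g (m * h) - g 0| := by rw [key]; simp [abs_mul]
      _ ≤ |g (m * h)| + |g 0| := abs_sub _ _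
      _ ≤ 2 * C := by linarith [hC (m * h), hC 0]
  linarith

/-- If a sum of bounded ridge functions in distinct directions vanishes identically, every profile
is constant. -/
theorem ridge_profile_const_of_sum_eq_zero {E ι : Type*} [NormedAddCommGroup E]
    [InnerProductSpace ℝ E] (s : Finset ι) (x : ι → E) (hx : Set.InjOn x s) (g : ι → ℝ → ℝ)
    (hb : ∀ i ∈ s, ∃ C, ∀ t, |g i t| ≤ C)
    (hg : ∀ (w : E) (b : ℝ), ∑ i ∈ s, g i (⟪w, x i⟫_ℝ + b) = 0) :
    ∀ i ∈ s, ∀ t t', g i t = g i t' := by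
  classical
  induction s using Finset.induction_on generalizing g with
  | empty => simp
  | insert j s hj ih =>
    have hconst : ∀ i ∈ s, ∀ t t', g i t = g i t' := by
      -- Moving `(w, b)` by `(v, -⟪v, x j⟫)` fixes the argument of the `j`-th ridge and shifts the
      -- others, so subtraction eliminates `j`. By induction the remaining differences are constant,
      -- and boundedness makes them zero.
      have hstep : ∀ v : E, ∀ i ∈ s, ∀ t, g i (t + ⟪v, x i - x j⟫_ℝ) - g i t = 0 := by
        intro v i hi
        have hc := ih (hx.mono (by simp)) (fun i t => g i (t + ⟪v, x i - x j⟫_ℝ) - g i t)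
          (fun i hi => by
            obtain ⟨C, hC⟩ := hb i (Finset.mem_insert_of_mem hi)
            exact ⟨C + C, fun t => (abs_sub _ _).trans (add_le_add (hC _) (hC _))⟩)
          (fun w b => by
            have h1 := hg (w + v) (b - ⟪v, x j⟫_ℝ)
            have h2 := hg w b
            rw [Finset.sum_insert hj] at h1 h2
            rw [Finset.sum_sub_distrib]
            have e1 : ⟪w + v, x j⟫_ℝ + (b - ⟪v, x j⟫_ℝ) = ⟪w, x j⟫_ℝ + b := by
              rw [inner_add_left]; ring
            have e2 : ∀ i, ⟪w + v, x i⟫_ℝ + (b - ⟪v, x j⟫_ℝ)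
                = ⟪w, x i⟫_ℝ + b + ⟪v, x i - x j⟫_ℝ := by
              intro i
              rw [inner_add_left, inner_sub_right]; ring
            rw [e1] at h1
            simp only [e2] at h1
            linarith) i hi
        obtain ⟨C, hC⟩ := hb i (Finset.mem_insert_of_mem hi)
        have h0 := eq_zero_of_bounded_of_forall_add_sub_eq hC (fun t => hc t 0)
        intro t
        rw [hc t 0, h0]
      intro i hi t t'
      have hne : x i - x j ≠ 0 := by
        rw [sub_ne_zero]
        intro h
        have := hx (by simp [hi]) (by simp) h
        exact hj (this ▸ hi)
      -- This `v` satisfies `⟪v, x i - x j⟫ = t - t'`.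
      have h := hstep (((t - t') / ‖x i - x j‖ ^ 2) • (x i - x j)) i hi t'
      rw [real_inner_smul_left, real_inner_self_eq_norm_sq,
        div_mul_cancel₀ _ (by simpa using hne), add_sub_cancel] at h
      linarith
    intro i hi t t'
    rcases Finset.mem_insert.1 hi with rfl | hi
    · have h1 := hg 0 t
      have h2 := hg 0 t'
      rw [Finset.sum_insert hj] at h1 h2
      rw [Finset.sum_congr rfl fun k hk => hconst k hk _ (⟪(0 : E), x k⟫_ℝ + t')] at h1
      simp only [inner_zero_left, zero_add] at h1 h2
      linarith
    · exact hconst i hi t t'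

/-! ### The standard Gaussian measure -/

/-- Upgrades almost-everywhere vanishing of a continuous function to vanishing everywhere. -/
instance isOpenPosMeasure_stdGaussian {ι : Type*} [Fintype ι] :
    (stdGaussian (EuclideanSpace ℝ ι)).IsOpenPosMeasure := by
  have h1 : (gaussianReal 0 1).IsOpenPosMeasure :=
    (gaussianReal_absolutelyContinuous' 0 one_ne_zero).isOpenPosMeasure
  rw [← map_pi_eq_stdGaussian]
  exact (PiLp.continuous_toLp 2 _).isOpenPosMeasure_map (WithLp.toLp_surjective 2)

/-- The reflection of `ℝ^ι × ℝ^κ` in the first factor. -/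
def negInl (ι κ : Type*) [Fintype ι] [Fintype κ] :
    EuclideanSpace ℝ (ι ⊕ κ) ≃ₗᵢ[ℝ] EuclideanSpace ℝ (ι ⊕ κ) :=
  LinearIsometryEquiv.piLpCongrRight 2 fun k =>
    Sum.elim (fun _ => LinearIsometryEquiv.neg ℝ) (fun _ => LinearIsometryEquiv.refl ℝ ℝ) k

theorem negInl_inl {ι κ : Type*} [Fintype ι] [Fintype κ] (v : EuclideanSpace ℝ (ι ⊕ κ)) (i : ι) :
    negInl ι κ v (Sum.inl i) = -v (Sum.inl i) := by
  simp [negInl]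

theorem negInl_inr {ι κ : Type*} [Fintype ι] [Fintype κ] (v : EuclideanSpace ℝ (ι ⊕ κ)) (k : κ) :
    negInl ι κ v (Sum.inr k) = v (Sum.inr k) := by
  simp [negInl]

/-- The reflection preserves the measure, so the integral equals its own negative. Integrability is
not needed. -/
theorem integral_stdGaussian_eq_zero_of_odd {ι κ F : Type*} [Fintype ι] [Fintype κ]
    [NormedAddCommGroup F] [NormedSpace ℝ F] {f : EuclideanSpace ℝ (ι ⊕ κ) → F}
    (hf : ∀ v, f (negInl ι κ v) = -f v) :
    ∫ v, f v ∂(stdGaussian (EuclideanSpace ℝ (ι ⊕ κ))) = 0 := by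
  have h : ∫ v, f v ∂(stdGaussian (EuclideanSpace ℝ (ι ⊕ κ)))
      = -∫ v, f v ∂(stdGaussian (EuclideanSpace ℝ (ι ⊕ κ))) := by
    conv_lhs => rw [← stdGaussian_map (negInl ι κ)]
    have hemb : MeasurableEmbedding (negInl ι κ) :=
      (negInl ι κ).toHomeomorph.measurableEmbedding
    rw [hemb.integral_map, ← integral_neg]
    exact integral_congr_ae (.of_forall hf)
  have : IsAddTorsionFree F := .of_isTorsionFree ℝ F
  exact self_eq_neg.1 h

/-! ### Smallest eigenvalues and Gram matrices -/

/-- Each eigenvalue is the quadratic form at a unit eigenvector. `0 < n` keeps the spectrum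
nonempty, so `sInf` is not a default value. -/
theorem le_lambdaMin_of_forall_le_quadForm {n : ℕ} (hn : 0 < n) {A : Matrix (Fin n) (Fin n) ℝ}
    (hA : A.IsHermitian) {r : ℝ}
    (h : ∀ c : Fin n → ℝ, ∑ i, c i ^ 2 = 1 → r ≤ c ⬝ᵥ A.mulVec c) :
    r ≤ MeanFieldResNet.lambdaMin A := by
  rw [MeanFieldResNet.lambdaMin, hA.spectrum_real_eq_range_eigenvalues]
  have : Nonempty (Fin n) := ⟨⟨0, hn⟩⟩
  refine le_csInf (Set.range_nonempty _) ?_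
  rintro _ ⟨i, rfl⟩
  rw [hA.eigenvalues_eq]
  simp only [star_trivial, RCLike.re_to_real]
  apply h
  rw [← EuclideanSpace.real_norm_sq_eq, hA.eigenvectorBasis.orthonormal.1 i, one_pow]

/-- The quadratic form is the integral of a sum of squares over the parameter coordinates; only the
`k₀` term is kept. -/
theorem integral_sq_le_quadForm_gram {Ω m : Type*} [MeasurableSpace Ω] [Fintype m] {n : ℕ}
    {μ : Measure Ω} (J : Ω → Matrix (Fin n) m ℝ) (hJ : ∀ i k, MemLp (fun ω => J ω i k) 2 μ)
    (k₀ : m) (c : Fin n → ℝ) :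
    ∫ ω, (∑ i, c i * J ω i k₀) ^ 2 ∂μ ≤
      c ⬝ᵥ (Matrix.of fun i j => ∫ ω, (J ω * (J ω).transpose) i j ∂μ).mulVec c := by
  have hint : ∀ i j k, Integrable (fun ω => J ω i k * J ω j k) μ :=
    fun i j k => (hJ i k).integrable_mul (hJ j k)
  have hsum : ∀ k, MemLp (fun ω => ∑ i, c i * J ω i k) 2 μ :=
    fun k => memLp_finsetSum _ fun i _ => (hJ i k).const_mul (c i)
  have h1 : c ⬝ᵥ (Matrix.of fun i j => ∫ ω, (J ω * (J ω).transpose) i j ∂μ).mulVec c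
      = ∫ ω, ∑ k, (∑ i, c i * J ω i k) ^ 2 ∂μ := by
    have h2 : ∀ ω, ∑ k, (∑ i, c i * J ω i k) ^ 2
        = ∑ i, ∑ j, c i * (c j * (J ω * (J ω).transpose) i j) := by
      intro ω
      simp only [sq, Finset.sum_mul_sum]
      simp only [Matrix.mul_apply, Matrix.transpose_apply, Finset.mul_sum]
      rw [Finset.sum_comm]
      refine Finset.sum_congr rfl fun i _ => ?_
      rw [Finset.sum_comm]
      refine Finset.sum_congr rfl fun j _ => Finset.sum_congr rfl fun k _ => by ring
    have h3 : ∀ i j, Integrable (fun ω => (J ω * (J ω).transpose) i j) μ := by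
      intro i j
      simp only [Matrix.mul_apply, Matrix.transpose_apply]
      exact integrable_finsetSum _ fun k _ => hint i j k
    simp only [h2]
    rw [integral_finsetSum _ fun i _ =>
      integrable_finsetSum _ fun j _ => ((h3 i j).const_mul _).const_mul _]
    simp only [dotProduct, Matrix.mulVec, Matrix.of_apply, Finset.mul_sum]
    refine Finset.sum_congr rfl fun i _ => ?_
    rw [integral_finsetSum _ fun j _ => ((h3 i j).const_mul _).const_mul _]
    refine Finset.sum_congr rfl fun j _ => ?_
    rw [integral_const_mul, integral_const_mul]
    ring
  rw [h1]
  refine integral_mono (hsum k₀).integrable_sq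
    (integrable_finsetSum _ fun k _ => (hsum k).integrable_sq) fun ω => ?_
  exact Finset.single_le_sum (f := fun k => (∑ i, c i * J ω i k) ^ 2)
    (fun k _ => sq_nonneg _) (Finset.mem_univ k₀)

/-! ### Separated points on the sphere -/

/-- Such unit vectors are `√(2 - 2 * C)` apart, so in a finite cover of the sphere by balls of half
that radius each ball holds at most one. -/
theorem exists_card_le_of_inner_le {E : Type*} [NormedAddCommGroup E] [InnerProductSpace ℝ E]
    [FiniteDimensional ℝ E] {C : ℝ} (hC : C < 1) :
    ∃ N : ℕ, ∀ (n : ℕ) (x : Fin n → E), (∀ i, ‖x i‖ = 1) →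
      (∀ i j, i ≠ j → ⟪x i, x j⟫_ℝ ≤ C) → n ≤ N := by
  have hε : 0 < √(2 - 2 * C) / 2 := by
    have : 0 < √(2 - 2 * C) := Real.sqrt_pos.2 (by linarith)
    positivity
  obtain ⟨t, ht, hcov⟩ := Metric.totallyBounded_iff.1
    (isCompact_sphere (0 : E) 1).totallyBounded _ hε
  refine ⟨ht.toFinset.card, fun n x hx hxx => ?_⟩
  have hmem : ∀ i, ∃ y ∈ t, dist (x i) y < √(2 - 2 * C) / 2 := by
    intro i
    have := hcov (show x i ∈ Metric.sphere (0 : E) 1 by simp [hx])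
    simpa using this
  choose f hft hf using hmem
  have hinj : Function.Injective f := by
    intro i j hij
    by_contra hne
    have h1 : dist (x i) (x j) < √(2 - 2 * C) := by
      have h2 := hf j
      rw [← hij] at h2
      linarith [dist_triangle_right (x i) (x j) (f i), hf i]
    rw [dist_eq_norm, Real.lt_sqrt (norm_nonneg _), norm_sub_sq_real, hx, hx] at h1
    linarith [hxx i j hne]
  simpa using Finset.card_le_card_of_injOn (s := Finset.univ) (t := ht.toFinset) f
    (fun i _ => by simpa using hft i) hinj.injOn

namespace MeanFieldResNet

variable {d n : ℕ}

/-! ### The flows at initialization -/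

theorem resBlock_negInl (σ₀ : ℝ → ℝ) (z : Input d) (θ : Theta d) :
    resBlock σ₀ z (negInl _ _ θ) = -resBlock σ₀ z θ := by
  have hU : thetaU (negInl _ _ θ) = -thetaU θ := by
    ext k; simp [thetaU, negInl_inl]
  have hW : thetaW (negInl _ _ θ) = thetaW θ := by
    ext k; simp [thetaW, negInl_inr]
  have hB : thetaB (negInl _ _ θ) = thetaB θ := by
    simp [thetaB, negInl_inr]
  rw [resBlock, hU, hW, hB, resBlock, smul_neg]

theorem predictor_negInl (σ₀ : ℝ → ℝ) (z : Input d) (ω : Omega d) :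
    predictor σ₀ z (negInl _ _ ω) = -predictor σ₀ z ω := by
  have hA : omegaA (negInl _ _ ω) = -omegaA ω := by
    simp [omegaA, negInl_inl]
  have hW : omegaW (negInl _ _ ω) = omegaW ω := by
    ext k; simp [omegaW, negInl_inr]
  have hB : omegaB (negInl _ _ ω) = omegaB ω := by
    simp [omegaB, negInl_inr]
  rw [predictor, hA, hW, hB, predictor, neg_mul]

theorem integral_resBlock_initNu (σ₀ : ℝ → ℝ) (z : Input d) (s : ℝ) :
    ∫ θ, resBlock σ₀ z θ ∂(initNu d s) = 0 :=
  integral_stdGaussian_eq_zero_of_odd (resBlock_negInl σ₀ z)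

theorem integral_fderiv_resBlock_initNu (σ₀ : ℝ → ℝ) (z : Input d) (s : ℝ) :
    ∫ θ, fderiv ℝ (fun z => resBlock σ₀ z θ) z ∂(initNu d s) = 0 := by
  refine integral_stdGaussian_eq_zero_of_odd fun θ => ?_
  simp only [resBlock_negInl]
  exact fderiv_fun_neg

theorem integral_gradient_predictor_initTau (σ₀ : ℝ → ℝ) (z : Input d) :
    ∫ ω, gradient (fun z => predictor σ₀ z ω) z ∂(initTau d) = 0 := by
  refine integral_stdGaussian_eq_zero_of_odd fun ω => ?_
  simp only [predictor_negInl, gradient]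
  rw [fderiv_fun_neg, map_neg]

theorem eq_of_hasDerivWithinAt_zero {E : Type*} [NormedAddCommGroup E] [NormedSpace ℝ E]
    {f : ℝ → E} {a b : ℝ} (hf : ∀ s ∈ Set.Icc a b, HasDerivWithinAt f 0 (Set.Icc a b) s)
    {s t : ℝ} (hs : s ∈ Set.Icc a b) (ht : t ∈ Set.Icc a b) : f s = f t := by
  have h := constant_of_derivWithin_zero (fun s hs => (hf s hs).differentiableWithinAt)
    (fun s hs => (hf s (Set.Ico_subset_Icc_self hs)).derivWithin
      (uniqueDiffOn_Icc (hs.1.trans_lt hs.2) s (Set.Ico_subset_Icc_self hs)))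
  rw [h s hs, h t ht]

theorem resNetFlow_initNu (α : ℝ) (σ₀ : ℝ → ℝ) (x : Input d) {s : ℝ}
    (hs : s ∈ Set.Icc (0 : ℝ) 1) : resNetFlow α σ₀ (initNu d) x s = x := by
  have hex : ∃ z, IsResNetTrajectory α σ₀ (initNu d) x z := by
    refine ⟨fun _ => x, rfl, fun s _ => ?_⟩
    rw [integral_resBlock_initNu, smul_zero]
    exact hasDerivWithinAt_const _ _ _
  rw [resNetFlow, dif_pos hex]
  -- The chosen solution need not be the constant one exhibited, but every solution has zero
  -- derivative.
  obtain ⟨h0, h⟩ := hex.choose_spec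
  simp only [integral_resBlock_initNu, smul_zero] at h
  rw [eq_of_hasDerivWithinAt_zero h hs (Set.left_mem_Icc.2 zero_le_one), h0]

theorem adjointFlow_init (α : ℝ) (σ₀ : ℝ → ℝ) (x : Input d) {s : ℝ}
    (hs : s ∈ Set.Icc (0 : ℝ) 1) : adjointFlow α σ₀ (initTau d) (initNu d) x s = 0 := by
  have hex : ∃ p, IsAdjointTrajectory α σ₀ (initTau d) (initNu d) x p := by
    refine ⟨fun _ => 0, (integral_gradient_predictor_initTau _ _).symm, fun s _ => ?_⟩
    rw [map_zero, smul_zero, neg_zero]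
    exact hasDerivWithinAt_const _ _ _
  rw [adjointFlow, dif_pos hex]
  obtain ⟨h1, h⟩ := hex.choose_spec
  rw [integral_gradient_predictor_initTau] at h1
  simp only [integral_fderiv_resBlock_initNu, map_zero, zero_apply, smul_zero,
    neg_zero] at h
  rw [eq_of_hasDerivWithinAt_zero h hs (Set.right_mem_Icc.2 zero_le_one), h1]

/-- At initialization the adjoint state vanishes, so the residual layers do not contribute. -/
theorem gram1_init (α : ℝ) (σ₀ : ℝ → ℝ) (x : Fin n → Input d) :
    gram1 α σ₀ x (initTau d) (initNu d) = 0 := by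
  ext i j
  simp only [gram1, Matrix.of_apply, Matrix.zero_apply]
  rw [intervalIntegral.integral_congr (g := fun _ => (0 : ℝ)), intervalIntegral.integral_zero]
  intro s hs
  rw [Set.uIcc_of_le zero_le_one] at hs
  have hJ : ∀ θ, J1 α σ₀ x (initTau d) (initNu d) θ s = 0 := by
    intro θ
    ext i k
    simp [J1, adjointFlow_init α σ₀ (x i) hs]
  simp [hJ]

theorem gram_init (α : ℝ) (σ₀ : ℝ → ℝ) (x : Fin n → Input d) :
    gram α σ₀ x (initTau d) (initNu d) = gram2 α σ₀ x (initTau d) (initNu d) := by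
  rw [gram, gram1_init, smul_zero, zero_add]

/-! ### The output layer at initialization -/

/-- The vector `(0, z, 1)`, whose inner product with `ω = (a, w, b)` is `wᵀ z + b`. -/
def affineLift (z : Input d) : Omega d :=
  WithLp.toLp 2 (Sum.elim 0 (Sum.elim z 1))

theorem inner_affineLift (z : Input d) (ω : Omega d) :
    ⟪affineLift z, ω⟫_ℝ = ⟪omegaW ω, z⟫_ℝ + omegaB ω := by
  simp [affineLift, omegaW, omegaB, PiLp.inner_apply, mul_comm]

theorem continuous_affineLift : Continuous (affineLift : Input d → Omega d) := by
  refine (PiLp.continuous_toLp 2 _).comp (continuous_pi fun k => ?_)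
  rcases k with k | k | k
  · exact continuous_const
  · exact (continuous_apply k).comp (PiLp.continuous_ofLp 2 _)
  · exact continuous_const

/-- The coordinate `a` of `ω = (a, w, b)` as a continuous linear functional. -/
def omegaAL (d : ℕ) : Omega d →L[ℝ] ℝ := EuclideanSpace.proj (Sum.inl ())

theorem predictor_eq (σ₀ : ℝ → ℝ) (z : Input d) (ω : Omega d) :
    predictor σ₀ z ω = omegaAL d ω * σ₀ (innerSL ℝ (affineLift z) ω) := by
  rw [innerSL_apply_apply, inner_affineLift]
  rfl

theorem hasFDerivAt_predictor {σ₀ : ℝ → ℝ} (hσ : Differentiable ℝ σ₀) (z : Input d)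
    (ω : Omega d) :
    HasFDerivAt (fun ω => predictor σ₀ z ω)
      (omegaAL d ω • (deriv σ₀ (innerSL ℝ (affineLift z) ω) • innerSL ℝ (affineLift z))
        + σ₀ (innerSL ℝ (affineLift z) ω) • omegaAL d) ω := by
  simp only [predictor_eq]
  exact (omegaAL d).hasFDerivAt.mul
    ((hσ _).hasDerivAt.comp_hasFDerivAt ω (innerSL ℝ (affineLift z)).hasFDerivAt)

theorem gradient_apply {ι : Type*} [Fintype ι] [DecidableEq ι] (f : EuclideanSpace ℝ ι → ℝ)
    (v : EuclideanSpace ℝ ι) (k : ι) :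
    gradient f v k = fderiv ℝ f v (EuclideanSpace.single k 1) := by
  have h := InnerProductSpace.toDual_symm_apply (𝕜 := ℝ)
    (x := EuclideanSpace.single k (1 : ℝ)) (y := fderiv ℝ f v)
  rw [← h, EuclideanSpace.inner_single_right]
  simp [gradient]

theorem J2_initNu {σ₀ : ℝ → ℝ} (hσ : Differentiable ℝ σ₀) (α : ℝ) (x : Fin n → Input d)
    (ω : Omega d) (i : Fin n) (k : OmegaIdx d) :
    J2 α σ₀ x (initNu d) ω i k =
      omegaAL d ω * deriv σ₀ (innerSL ℝ (affineLift (x i)) ω) * affineLift (x i) k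
        + σ₀ (innerSL ℝ (affineLift (x i)) ω) * omegaAL d (EuclideanSpace.single k 1) := by
  classical
  simp only [J2, Matrix.of_apply]
  rw [gradient_apply, resNetFlow_initNu α σ₀ (x i) (Set.right_mem_Icc.2 zero_le_one),
    (hasFDerivAt_predictor hσ (x i) ω).fderiv]
  simp only [add_apply, smul_apply, smul_eq_mul,
    innerSL_apply_apply, EuclideanSpace.inner_single_right]
  simp [mul_assoc]

/-- The bias coordinate involves only `σ₀'`, which is bounded as the ridge argument requires; `σ₀`
itself may grow linearly. -/
theorem J2_initNu_bias {σ₀ : ℝ → ℝ} (hσ : Differentiable ℝ σ₀) (α : ℝ) (x : Fin n → Input d)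
    (ω : Omega d) (i : Fin n) :
    J2 α σ₀ x (initNu d) ω i (Sum.inr (Sum.inr ())) =
      omegaAL d ω * deriv σ₀ (innerSL ℝ (affineLift (x i)) ω) := by
  rw [J2_initNu hσ]
  simp [affineLift, omegaAL]

theorem memLp_clm_initTau (L : Omega d →L[ℝ] ℝ) : MemLp (fun ω => L ω) 2 (initTau d) :=
  L.comp_memLp' (IsGaussian.memLp_two_id (μ := stdGaussian (Omega d)))

instance : IsProbabilityMeasure (initTau d) := isProbabilityMeasure_stdGaussian

instance : (initTau d).IsOpenPosMeasure := isOpenPosMeasure_stdGaussian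

theorem memLp_J2_initNu {C₁ : ℝ} {σ₀ : ℝ → ℝ} (hσ : ActivationAssumption C₁ σ₀) (α : ℝ)
    (x : Fin n → Input d) (i : Fin n) (k : OmegaIdx d) :
    MemLp (fun ω => J2 α σ₀ x (initNu d) ω i k) 2 (initTau d) := by
  have hC : 0 ≤ C₁ := (abs_nonneg _).trans (hσ.deriv_le 0)
  have hc : Continuous (deriv σ₀) := hσ.differentiable_deriv.continuous
  have hc0 : Continuous σ₀ := hσ.differentiable.continuous
  simp only [J2_initNu hσ.differentiable]
  refine MemLp.add (MemLp.mul_const ?_ _) (MemLp.mul_const ?_ _)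
  · refine ((memLp_clm_initTau (omegaAL d)).const_mul C₁).mono
      (Continuous.aestronglyMeasurable (by fun_prop)) (.of_forall fun ω => ?_)
    rw [norm_mul, norm_mul, mul_comm, Real.norm_of_nonneg hC]
    exact mul_le_mul_of_nonneg_right (hσ.deriv_le _) (norm_nonneg _)
  · refine ((((memLp_clm_initTau (innerSL ℝ (affineLift (x i)))).norm).add
      (memLp_const (1 : ℝ))).const_mul C₁).mono
      (Continuous.aestronglyMeasurable (by fun_prop)) (.of_forall fun ω => ?_)
    refine (hσ.growth _).trans (le_trans ?_ (le_abs_self _))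
    refine mul_le_mul_of_nonneg_left ?_ hC
    simp only [Pi.add_apply, Real.norm_eq_abs]
    exact max_le (by linarith) (by linarith [abs_nonneg (innerSL ℝ (affineLift (x i)) ω)])

/-! ### The lower bound -/

/-- The part of the quadratic form of `G₂` that comes from the bias coordinate. -/
def biasForm (g : ℝ → ℝ) (x : Fin n → Input d) (c : Fin n → ℝ) : ℝ :=
  ∫ ω, (∑ i, c i * (omegaAL d ω * g (innerSL ℝ (affineLift (x i)) ω))) ^ 2 ∂(initTau d)

theorem memLp_biasForm {g : ℝ → ℝ} {C : ℝ} (hg : Continuous g) (hb : ∀ t, |g t| ≤ C)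
    (x : Fin n → Input d) (c : Fin n → ℝ) :
    MemLp (fun ω => ∑ i, c i * (omegaAL d ω * g (innerSL ℝ (affineLift (x i)) ω))) 2
      (initTau d) := by
  have hC : 0 ≤ C := (abs_nonneg _).trans (hb 0)
  refine memLp_finsetSum _ fun i _ => MemLp.const_mul ?_ _
  refine ((memLp_clm_initTau (omegaAL d)).const_mul C).mono
    (Continuous.aestronglyMeasurable (by fun_prop)) (.of_forall fun ω => ?_)
  rw [norm_mul, norm_mul, mul_comm, Real.norm_of_nonneg hC]
  exact mul_le_mul_of_nonneg_right (hb _) (norm_nonneg _)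

theorem biasForm_pos {g : ℝ → ℝ} {C : ℝ} (hg : Continuous g) (hb : ∀ t, |g t| ≤ C)
    (hconst : ¬ ∀ t t', g t = g t') {x : Fin n → Input d} (hx : Function.Injective x)
    {c : Fin n → ℝ} (hc : c ≠ 0) : 0 < biasForm g x c := by
  refine lt_of_le_of_ne (integral_nonneg fun ω => sq_nonneg _) fun h0 => hc ?_
  have hcont : Continuous fun ω : Omega d =>
      (∑ i, c i * (omegaAL d ω * g (innerSL ℝ (affineLift (x i)) ω))) ^ 2 := by fun_prop
  have hz := (integral_eq_zero_iff_of_nonneg (fun ω => sq_nonneg _)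
    (memLp_biasForm hg hb x c).integrable_sq).1 h0.symm
  have hz := (hcont.ae_eq_iff_eq (initTau d) continuous_zero).1 hz
  have hsum : ∀ (w : Input d) (b : ℝ), ∑ i, c i * g (⟪w, x i⟫_ℝ + b) = 0 := by
    intro w b
    -- Evaluation at `ω = (1, w, b)` removes the factor `a`.
    have h := congrFun hz (WithLp.toLp 2 (Sum.elim 1 (Sum.elim w (fun _ => b))))
    simpa [innerSL_apply_apply, inner_affineLift, omegaAL, omegaW, omegaB] using h
  have hrid := ridge_profile_const_of_sum_eq_zero Finset.univ x hx.injOn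
    (fun i t => c i * g t) (fun i _ => ⟨|c i| * C, fun t => by
      rw [abs_mul]; exact mul_le_mul_of_nonneg_left (hb t) (abs_nonneg _)⟩) hsum
  ext i
  by_contra hi
  exact hconst fun t t' => mul_left_cancel₀ hi (hrid i (Finset.mem_univ i) t t')

/-- Dominated convergence: for `|c_i| ≤ 1` the integrand is at most `(n * C)² a²`, uniformly in `x`.
-/
theorem continuousOn_biasForm {g : ℝ → ℝ} {C : ℝ} (hg : Continuous g) (hb : ∀ t, |g t| ≤ C) :
    ContinuousOn (fun q : (Fin n → Input d) × (Fin n → ℝ) => biasForm g q.1 q.2)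
      {q | ∀ i, |q.2 i| ≤ 1} := by
  have hC : 0 ≤ C := (abs_nonneg _).trans (hb 0)
  refine continuousOn_of_dominated (bound := fun ω => (n * C) ^ 2 * (omegaAL d ω) ^ 2)
    (fun q _ => (memLp_biasForm hg hb q.1 q.2).integrable_sq.aestronglyMeasurable)
    (fun q hq => .of_forall fun ω => ?_)
    ((memLp_clm_initTau (omegaAL d)).integrable_sq.const_mul _)
    (.of_forall fun ω => Continuous.continuousOn ?_)
  · rw [Real.norm_eq_abs, abs_of_nonneg (sq_nonneg _), ← mul_pow, sq_le_sq]
    refine (Finset.abs_sum_le_sum_abs _ _).trans ?_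
    refine (Finset.sum_le_card_nsmul _ _ (C * |omegaAL d ω|) fun i _ => ?_).trans_eq ?_
    · rw [abs_mul, abs_mul, mul_comm |omegaAL d ω|, ← one_mul (C * _)]
      exact mul_le_mul (hq i) (mul_le_mul_of_nonneg_right (hb _) (abs_nonneg _))
        (by positivity) zero_le_one
    · rw [Finset.card_univ, Fintype.card_fin, nsmul_eq_mul, abs_mul, abs_mul, Nat.abs_cast,
        abs_of_nonneg hC, mul_assoc]
  · have := continuous_affineLift (d := d)
    simp only [innerSL_apply_apply]
    fun_prop

theorem exists_biasForm_lower_bound {g : ℝ → ℝ} {C Cmax : ℝ} (hg : Continuous g)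
    (hb : ∀ t, |g t| ≤ C) (hconst : ¬ ∀ t t', g t = g t') (hCmax : Cmax < 1) (d n : ℕ) :
    ∃ r > 0, ∀ x : Fin n → Input d, (∀ i, ‖x i‖ = 1) → (∀ i j, i ≠ j → ⟪x i, x j⟫_ℝ ≤ Cmax) →
      ∀ c : Fin n → ℝ, ∑ i, c i ^ 2 = 1 → r ≤ biasForm g x c := by
  let K : Set ((Fin n → Input d) × (Fin n → ℝ)) :=
    {q | (∀ i, ‖q.1 i‖ = 1) ∧ (∀ i j, i ≠ j → ⟪q.1 i, q.1 j⟫_ℝ ≤ Cmax) ∧ ∑ i, q.2 i ^ 2 = 1}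
  have hle : ∀ c : Fin n → ℝ, ∑ i, c i ^ 2 = 1 → ∀ i, |c i| ≤ 1 := by
    intro c hc i
    rw [← sq_le_one_iff_abs_le_one, ← hc]
    exact Finset.single_le_sum (f := fun i => c i ^ 2) (fun i _ => sq_nonneg _)
      (Finset.mem_univ i)
  have hclosed : IsClosed K := by
    refine IsClosed.and ?_ (IsClosed.and ?_ ?_)
    · simp only [Set.ofPred_forall]
      exact isClosed_iInter fun i => isClosed_eq (by fun_prop) continuous_const
    · simp only [Set.ofPred_forall]
      exact isClosed_iInter fun i => isClosed_iInter fun j => isClosed_iInter fun _ =>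
        isClosed_le (by fun_prop) continuous_const
    · exact isClosed_eq (by fun_prop) continuous_const
  have hcomp : IsCompact K := by
    refine (isCompact_closedBall 0 1).of_isClosed_subset hclosed fun q hq => ?_
    rw [mem_closedBall_zero_iff, Prod.norm_def]
    exact max_le ((pi_norm_le_iff_of_nonneg zero_le_one).2 fun i => (hq.1 i).le)
      ((pi_norm_le_iff_of_nonneg zero_le_one).2 fun i => hle _ hq.2.2 i)
  rcases K.eq_empty_or_nonempty with hK | hK
  -- With no admissible pair, as for `n = 0`, any positive constant works.
  · exact ⟨1, one_pos, fun x h1 h2 c hc =>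
      absurd (show (x, c) ∈ K from ⟨h1, h2, hc⟩) (by simp [hK])⟩
  obtain ⟨q, hq, hmin⟩ := hcomp.exists_isMinOn hK
    ((continuousOn_biasForm hg hb).mono fun q hq => hle _ hq.2.2)
  refine ⟨biasForm g q.1 q.2, biasForm_pos hg hb hconst ?_ ?_, fun x h1 h2 c hc =>
    hmin (show (x, c) ∈ K from ⟨h1, h2, hc⟩)⟩
  · intro i j hij
    by_contra hne
    have h := hq.2.1 i j hne
    rw [← hij, real_inner_self_eq_norm_sq, hq.1 i] at h
    linarith
  · intro h
    have := hq.2.2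
    simp [h] at this

theorem isHermitian_gram2 (α : ℝ) (σ₀ : ℝ → ℝ) (x : Fin n → Input d) (τ : Measure (Omega d))
    (ν : ℝ → Measure (Theta d)) : (gram2 α σ₀ x τ ν).IsHermitian := by
  ext i j
  simp [gram2, Matrix.mul_apply, mul_comm]

theorem le_lambdaMin_gram2_init {C₁ : ℝ} {σ₀ : ℝ → ℝ} (hσ : ActivationAssumption C₁ σ₀) (α : ℝ)
    (hn : 0 < n) (x : Fin n → Input d) {r : ℝ}
    (h : ∀ c : Fin n → ℝ, ∑ i, c i ^ 2 = 1 → r ≤ biasForm (deriv σ₀) x c) :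
    r ≤ lambdaMin (gram2 α σ₀ x (initTau d) (initNu d)) := by
  refine le_lambdaMin_of_forall_le_quadForm hn (isHermitian_gram2 _ _ _ _ _) fun c hc =>
    (h c hc).trans ?_
  have := integral_sq_le_quadForm_gram _ (memLp_J2_initNu hσ α x) (Sum.inr (Sum.inr ())) c
  simp only [J2_initNu_bias hσ.differentiable] at this
  exact this

theorem exists_affine_of_deriv_const {f : ℝ → ℝ} (hf : Differentiable ℝ f)
    (h : ∀ t t', deriv f t = deriv f t') : ∃ a b : ℝ, ∀ t, f t = a * t + b := by
  refine ⟨deriv f 0, f 0, fun t => ?_⟩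
  have hd : ∀ s, HasDerivAt (fun s => f s - deriv f 0 * s) 0 s := fun s => by
    have h1 := (hf s).hasDerivAt.fun_sub ((hasDerivAt_id s).const_mul (deriv f 0))
    rwa [mul_one, h s 0, sub_self] at h1
  have := is_const_of_deriv_eq_zero (fun s => (hd s).differentiableAt) (fun s => (hd s).deriv) t 0
  simp only [mul_zero, sub_zero] at this
  linarith

theorem exists_lambdaMin_gram2_lower_bound {C₁ Cmax : ℝ} {σ₀ : ℝ → ℝ}
    (hσ : ActivationAssumption C₁ σ₀) (hσ_not_affine : ¬ ∃ a b : ℝ, ∀ t, σ₀ t = a * t + b)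
    (hCmax : Cmax < 1) (d : ℕ) :
    ∃ r > 0, ∀ (n : ℕ) (x : Fin n → Input d) (α : ℝ), 0 < n → (∀ i, ‖x i‖ = 1) →
      (∀ i j, i ≠ j → ⟪x i, x j⟫_ℝ ≤ Cmax) →
      r ≤ lambdaMin (gram2 α σ₀ x (initTau d) (initNu d)) := by
  obtain ⟨N, hN⟩ := exists_card_le_of_inner_le (E := Input d) hCmax
  choose r hr hbound using exists_biasForm_lower_bound hσ.differentiable_deriv.continuous
    hσ.deriv_le (fun h => hσ_not_affine (exists_affine_of_deriv_const hσ.differentiable h))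
    hCmax d
  -- Only `n ≤ N` can occur, so the least of finitely many positive constants serves every `n`;
  -- `biasForm` does not involve `α`.
  obtain ⟨m, -, hm⟩ := (Finset.range (N + 1)).exists_min_image r ⟨0, by simp⟩
  refine ⟨r m, hr m, fun n x α hn h1 h2 => le_lambdaMin_gram2_init hσ α hn x fun c hc => ?_⟩
  exact (hm n (Finset.mem_range_succ_iff.2 (hN n x h1 h2))).trans (hbound n x h1 h2 c hc)

end MeanFieldResNet

end

theorem mainTheorem4 (σ₀ : ℝ → ℝ) (C₁ Cmax : ℝ)
    (hσ : MeanFieldResNet.ActivationAssumption C₁ σ₀)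
    (hσ_not_affine : ¬ ∃ a b : ℝ, ∀ t, σ₀ t = a * t + b) :
    ∃ Λ : ℕ → ℝ, ∀ d : ℕ, 0 < Λ d ∧
      ∀ (n : ℕ) (x : Fin n → MeanFieldResNet.Input d) (y : MeanFieldResNet.Input d → ℝ) (α : ℝ),
        0 < n → 0 < α → MeanFieldResNet.DataAssumption Cmax x y →
          MeanFieldResNet.lambdaMin
              (MeanFieldResNet.gram2 α σ₀ x (MeanFieldResNet.initTau d)
                (MeanFieldResNet.initNu d)) ≤
            MeanFieldResNet.lambdaMin
              (MeanFieldResNet.gram α σ₀ x (MeanFieldResNet.initTau d)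
                (MeanFieldResNet.initNu d)) ∧
          Λ d ≤
            MeanFieldResNet.lambdaMin
              (MeanFieldResNet.gram2 α σ₀ x (MeanFieldResNet.initTau d)
                (MeanFieldResNet.initNu d)) := by
  by_cases hCmax : Cmax < 1
  · choose Λ hΛ hbound using
      MeanFieldResNet.exists_lambdaMin_gram2_lower_bound hσ hσ_not_affine hCmax
    refine ⟨Λ, fun d => ⟨hΛ d, fun n x y α hn _ hx => ⟨?_, ?_⟩⟩⟩
    · rw [MeanFieldResNet.gram_init]
    · exact hbound d n x α hn hx.norm_eq_one hx.inner_le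
  -- For `Cmax ≥ 1` no data satisfy the assumption.
  · exact ⟨fun _ => 1, fun d => ⟨one_pos, fun n x y α _ _ hx => absurd hx.cmax_lt_one hCmax⟩⟩
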